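/- Let $k\ge 2$ and $L\ge 2$ be integers, and let $F_k$ be the free group on a set $X$ with $k$ elements, its elements being identified with the reduced words in the letters $X^{\pm1}$. Let $h\in F_k$ be a cyclically reduced word (that is, $h=a_1\cdots a_q$ is reduced and $a_q\ne a_1^{-1}$) such that every reduced word of length $L$ is a subword $a_i a_{i+1}\cdots a_j$ of $h$. A splitting of $F_k$ is an action of $F_k$ on a simplicial tree $T$ by automorphisms that is without inversion, is minimal (no proper invariant subtree) and is non-trivial (every vertex stabilizer is a proper subgroup); equivalently, $T$ is the Bass–Serre tree of a decomposition of $F_k$ as the fundamental group of a graph of groups. The splitting is over a subgroup $H$ if $H$ is the stabilizer of some edge of $T$, and an element is elliptic in the splitting if it fixes a point of $T$. If $h$ is elliptic in a splitting of $F_k$ over a subgroup isomorphic to the free group $F_r$ of finite rank $r\ge 0$, then $r>(k-1)(L-2)$. -/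

import Mathlib

namespace BassSerre

variable {G V : Type*} [Group G] [MulAction G V]

/-- The action of `G` on the vertex set `V` makes the graph `T` on `V` the Bass-Serre tree of a
(non-trivial) splitting of `G`: `T` is a tree, `G` acts on it by graph automorphisms, without
inversion and minimally, and every vertex group is a proper subgroup of `G`. -/
structure IsSplitting (G : Type*) {V : Type*} [Group G] [MulAction G V]
    (T : SimpleGraph V) : Prop where
  /-- `T` is a tree (connected, non-empty and without cycles). -/
  isTree : T.IsTree
  /-- Every `g` maps edges to edges; since `g⁻¹` does so too, `g` is a graph automorphism. -/
  adj_smul : ∀ (g : G) (v w : V), T.Adj v w → T.Adj (g • v) (g • w)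
  /-- An element leaving an edge invariant fixes its endpoints. -/
  not_inversion : ∀ (g : G) (v w : V), T.Adj v w → ¬ (g • v = w ∧ g • w = v)
  /-- There is no proper `G`-invariant subtree. -/
  minimal : ∀ S : Set V, (T.induce S).Connected → (∀ (g : G), ∀ v ∈ S, g • v ∈ S) → S = Set.univ
  /-- Vertex groups are proper subgroups. -/
  nontrivial : ∀ v : V, MulAction.stabilizer G v ≠ ⊤

/-- The stabilizer `G_e` of the edge `e` with endpoints `v` and `w`. As the action is without
inversion, leaving `e` invariant is the same as fixing both of its endpoints. -/
def edgeGroup (G : Type*) {V : Type*} [Group G] [MulAction G V] (v w : V) : Subgroup G :=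
  MulAction.stabilizer G v ⊓ MulAction.stabilizer G w

/-- `g` is elliptic: it fixes a point of the tree with vertex set `V`. As the action is without
inversion, an element that fixes a point inside an edge also fixes the endpoints of this edge, so
that it is enough to look at vertices. -/
def IsElliptic (V : Type*) [MulAction G V] (g : G) : Prop :=
  ∃ v : V, g • v = v

/-- The tree `T` is the Bass-Serre tree of a splitting of `G` over the subgroup `H`: it is a
splitting of `G`, and `H` is the stabilizer of one of its edges (other edges may exist). -/
def IsSplittingOver (T : SimpleGraph V) (H : Subgroup G) : Prop :=
  IsSplitting G T ∧ ∃ v w : V, T.Adj v w ∧ H = edgeGroup G v w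

end BassSerre

/-! Let `H` be the edge group and view `F_k / H` as the vertex set of its Schreier graph. If `h`
fixes the vertex `p`, the cosets `gH` with `g⁻¹ • p` in one half-tree of the edge form an
`h`-invariant set `A`, infinite with infinite complement, whose coboundary is finite
(`infinite_sideCosets`, `finite_coboundary_sideCosets`).

Since `H` has rank `r`, a finite non-empty subgraph has at most `r - 1` more edges than vertices
(`card_edges_add_one_le`). Outside a finite set `D` of maximal excess the graph consists of hanging
trees: a reduced path leaving `D` never returns (`IsMaxExcess.notMem_of_isReduced`). Once `D`
contains the coboundary of `A`, the branch behind a leaving edge is inside or outside `A`, which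
colors the edge; by `h`-invariance, the base points of all readings of `h` or `h⁻¹` through it share
this color. Pruning vertices of degree at most one preserves this (`isGood_erase`).

Leaving edges joined by a short reduced path are crossed by a single reading of `h`, so their colors
agree (`HasColor.iff_of_word`). Both colors occur, so a shortest path between opposite colors has at
least `L - 2` interior vertices, all of full degree `2k` in `D`. The other vertices have degree at
least 2, whence `2 * #D + 2(k - 1)(L - 2) ≤ #darts ≤ 2 * #D + 2r - 2`. -/

namespace FreeGroupAction

open Finset hiding mk
open FreeGroup (of mk invRev inv_mk IsReduced)

/-! ### Cocycles of a free group action. -/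

section Cocycle

variable {α Q M : Type*} [MulAction (FreeGroup α) Q] [AddCommGroup M]

/-- The free group acts on `Q × M` over its action on `Q`, the generator `i` translating the fibre
over `x` by `φ x i`. -/
def skewHom (φ : Q → α → M) : FreeGroup α →* Equiv.Perm (Q × M) :=
  FreeGroup.lift fun i =>
    { toFun := fun p => (of i • p.1, p.2 + φ p.1 i)
      invFun := fun p => ((of i)⁻¹ • p.1, p.2 - φ ((of i)⁻¹ • p.1) i)
      left_inv := fun p => by simp
      right_inv := fun p => by simp }

/-- The cocycle of the free group with prescribed values `φ` on the generators. -/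
def cocycle (φ : Q → α → M) (g : FreeGroup α) (x : Q) : M := (skewHom φ g (x, 0)).2

theorem skewHom_apply (φ : Q → α → M) (g : FreeGroup α) :
    ∀ x m, skewHom φ g (x, m) = (g • x, m + cocycle φ g x) := by
  unfold cocycle
  have inv : ∀ g : FreeGroup α,
      (∀ x m, skewHom φ g (x, m) = (g • x, m + (skewHom φ g (x, 0)).2)) →
      ∀ x m, skewHom φ g⁻¹ (x, m) = (g⁻¹ • x, m + (skewHom φ g⁻¹ (x, 0)).2) := by
    intro g hg
    have key : ∀ x m, skewHom φ g⁻¹ (x, m) =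
        (g⁻¹ • x, m - (skewHom φ g (g⁻¹ • x, 0)).2) := by
      intro x m
      rw [map_inv, Equiv.Perm.inv_eq_iff_eq, hg]
      simp
    intro x m
    rw [key, key]
    simp [sub_eq_add_neg]
  have pure : ∀ (i : α) x m,
      skewHom φ (of i) (x, m) = (of i • x, m + (skewHom φ (of i) (x, 0)).2) := by
    intro i x m
    simp [skewHom]
  induction g using FreeGroup.induction_on with
  | C1 => simp
  | of i => exact pure i
  | inv_of i _ => exact inv _ (pure i)
  | mul g g' hg hg' =>
    intro x m
    rw [map_mul, Equiv.Perm.mul_apply, Equiv.Perm.mul_apply, hg' x m, hg' x 0, hg (g' • x),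
      hg (g' • x) (0 + _)]
    simp [mul_smul, add_assoc]

theorem cocycle_mul (φ : Q → α → M) (g g' : FreeGroup α) (x : Q) :
    cocycle φ (g * g') x = cocycle φ g' x + cocycle φ g (g' • x) := by
  have := skewHom_apply φ (g * g') x 0
  rw [map_mul, Equiv.Perm.mul_apply, skewHom_apply φ g', skewHom_apply φ g] at this
  simpa using (congrArg Prod.snd this).symm

theorem cocycle_of (φ : Q → α → M) (i : α) (x : Q) : cocycle φ (of i) x = φ x i := by
  simp [cocycle, skewHom]

theorem cocycle_one (φ : Q → α → M) (x : Q) : cocycle φ 1 x = 0 := by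
  simp [cocycle]

theorem cocycle_inv (φ : Q → α → M) (g : FreeGroup α) (x : Q) :
    cocycle φ g⁻¹ x = -cocycle φ g (g⁻¹ • x) := by
  have := cocycle_mul φ g g⁻¹ x
  rw [mul_inv_cancel, cocycle_one] at this
  exact eq_neg_of_add_eq_zero_left this.symm

end Cocycle

/-! ### Rank of a stabilizer and edges of the Schreier graph. -/

section Rank

variable {α Q : Type*} [Fintype α] [DecidableEq α] [DecidableEq Q] [MulAction (FreeGroup α) Q]

/-- The edges of the Schreier graph with both ends in `D`. -/
def edges (D : Finset Q) : Finset (Q × α) := {e ∈ D ×ˢ univ | of e.2 • e.1 ∈ D}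

omit [DecidableEq α] in
theorem mem_edges {D : Finset Q} {e : Q × α} :
    e ∈ edges D ↔ e.1 ∈ D ∧ of e.2 • e.1 ∈ D := by
  simp [edges]

/-- If a point stabilizer is generated by `r` elements, a subgraph of the Schreier graph with
vertex set `D` has at most `r + #D - 1` edges. -/
theorem card_edges_add_one_le [MulAction.IsPretransitive (FreeGroup α) Q] {r : ℕ}
    (t : Fin r → FreeGroup α) (q : Q)
    (ht : Subgroup.closure (Set.range t) = MulAction.stabilizer (FreeGroup α) q)
    (D : Finset Q) (hD : D.Nonempty) : #(edges (α := α) D) + 1 ≤ r + #D := by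
  obtain ⟨d, hd⟩ := hD
  choose p hp using fun x : Q => MulAction.exists_smul_eq (FreeGroup α) q x
  let M := edges (α := α) D → ℚ
  -- Each edge inside `D` is weighted by its own basis vector, all others by 0. Normalizing the
  -- potentials at `d` saves one vector in `S`, whence `#D - 1`.
  let φ : Q → α → M := fun x i => if he : (x, i) ∈ edges (α := α) D then Pi.single ⟨_, he⟩ 1 else 0
  let S : Finset M := univ.image (fun j => cocycle φ (t j) q) ∪
    (D.erase d).image fun x => cocycle φ (p x) q - cocycle φ (p d) q
  have hS : #S ≤ r + (#D - 1) := by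
    refine (card_union_le _ _).trans (add_le_add (card_image_le.trans (by simp)) ?_)
    exact card_image_le.trans (by rw [card_erase_of_mem hd])
  have hstab : ∀ g ∈ MulAction.stabilizer (FreeGroup α) q,
      cocycle φ g q ∈ Submodule.span ℚ (S : Set M) := by
    intro g hg
    have hg' := hg
    rw [← ht] at hg
    induction hg using Subgroup.closure_induction with
    | mem x hx =>
      obtain ⟨j, rfl⟩ := hx
      exact Submodule.subset_span (by simp [S])
    | one => rw [cocycle_one]; exact Submodule.zero_mem _
    | mul x y hx hy ihx ihy =>
      rw [ht] at hx hy
      rw [cocycle_mul, MulAction.mem_stabilizer_iff.1 hy]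
      exact Submodule.add_mem _ (ihy hy) (ihx hx)
    | inv x hx ih =>
      rw [ht] at hx
      rw [cocycle_inv, MulAction.mem_stabilizer_iff.1 hg']
      exact Submodule.neg_mem _ (ih hx)
  have hpot : ∀ x ∈ D, cocycle φ (p x) q - cocycle φ (p d) q ∈ Submodule.span ℚ (S : Set M) := by
    intro x hx
    by_cases hxd : x = d
    · subst hxd; simp
    · refine Submodule.subset_span (mem_coe.2 (mem_union_right _ (mem_image.2 ⟨x, ?_, rfl⟩)))
      simp [hx, hxd]
  -- Closing the edge up with `p` gives a loop at `q`; the basis vector is the value of this loop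
  -- plus a difference of potentials.
  have hsingle : ∀ e : edges (α := α) D, Pi.single e (1 : ℚ) ∈ Submodule.span ℚ (S : Set M) := by
    rintro ⟨⟨x, i⟩, he⟩
    have hx : x ∈ D ∧ of i • x ∈ D := mem_edges.1 he
    have h1 : cocycle φ (of i) x = Pi.single ⟨(x, i), he⟩ 1 := by
      rw [cocycle_of]; simp [φ, he]
    have hg : (p (of i • x))⁻¹ * (of i * p x) ∈ MulAction.stabilizer (FreeGroup α) q := by
      rw [MulAction.mem_stabilizer_iff, mul_smul, mul_smul, hp, inv_smul_eq_iff, hp]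
    have h2 := hstab _ hg
    rw [cocycle_mul, cocycle_mul, hp, h1, mul_smul, hp, cocycle_inv, inv_smul_eq_iff.2 (hp _).symm]
      at h2
    have h3 := Submodule.sub_mem _ (Submodule.add_mem _ h2 (hpot _ hx.2)) (hpot _ hx.1)
    convert h3 using 1
    abel
  have htop : Submodule.span ℚ (S : Set M) = ⊤ := by
    rw [eq_top_iff, ← (Pi.basisFun ℚ (edges (α := α) D)).span_eq, Submodule.span_le]
    rintro _ ⟨e, rfl⟩
    rw [Pi.basisFun_apply]
    exact hsingle e
  have h := finrank_span_finset_le_card (R := ℚ) S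
  rw [Set.finrank, htop, finrank_top, Module.finrank_fintype_fun_eq_card, Fintype.card_coe] at h
  have := card_pos.2 ⟨d, hd⟩
  omega

/-- The oriented edges of the Schreier graph with both ends in `D`. -/
def darts (D : Finset Q) : Finset (Q × (α × Bool)) := {e ∈ D ×ˢ univ | mk [e.2] • e.1 ∈ D}

omit [DecidableEq α] in
theorem mem_darts {D : Finset Q} {e : Q × (α × Bool)} :
    e ∈ darts D ↔ e.1 ∈ D ∧ mk [e.2] • e.1 ∈ D := by
  simp [darts]

theorem mk_inv_letter {α : Type*} (i : α) (b : Bool) : mk [(i, !b)] = (mk [(i, b)])⁻¹ := by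
  simp [inv_mk, invRev]

omit [DecidableEq α] in
theorem card_darts_le (D : Finset Q) : #(darts (α := α) D) ≤ 2 * #(edges (α := α) D) := by
  have : #(edges (α := α) D ×ˢ (univ : Finset Bool)) = 2 * #(edges (α := α) D) := by
    rw [card_product, card_univ, Fintype.card_bool, mul_comm]
  rw [← this]
  refine card_le_card_of_injOn
    (fun e => ((if e.2.2 then e.1 else mk [e.2] • e.1, e.2.1), e.2.2)) ?_ ?_
  · rintro ⟨x, i, b⟩ he
    have he := mem_darts.1 (mem_coe.1 he)
    cases b
    · have h : of i = (mk [(i, false)])⁻¹ := mk_inv_letter i false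
      have := (mem_edges (D := D) (e := (mk [(i, false)] • x, i))).2 ⟨he.2, by
        rw [h, inv_smul_smul]; exact he.1⟩
      simpa using this
    · have := (mem_edges (D := D) (e := (x, i))).2 he
      simpa using this
  · rintro ⟨x, i, b⟩ - ⟨y, j, c⟩ - h
    simp only [Prod.mk.injEq] at h
    obtain ⟨⟨h1, rfl⟩, rfl⟩ := h
    cases b <;> simp_all

theorem card_darts_add_two_le [MulAction.IsPretransitive (FreeGroup α) Q] {r : ℕ}
    (t : Fin r → FreeGroup α) (q : Q)
    (ht : Subgroup.closure (Set.range t) = MulAction.stabilizer (FreeGroup α) q)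
    (D : Finset Q) (hD : D.Nonempty) : #(darts (α := α) D) + 2 ≤ 2 * r + 2 * #D := by
  have h1 := card_edges_add_one_le t q ht D hD
  have h2 := card_darts_le (α := α) D
  omega

end Rank

/-! ### Letters and reduced words. -/

section Letters

variable {α : Type*}

/-- The inverse of a letter. -/
def bar (s : α × Bool) : α × Bool := (s.1, !s.2)

theorem bar_bar (s : α × Bool) : bar (bar s) = s := by simp [bar]

theorem bar_ne_self (s : α × Bool) : bar s ≠ s := by
  intro h
  simpa [bar] using congrArg Prod.snd h

theorem ne_bar_iff {s t : α × Bool} : s ≠ bar t ↔ (s.1 = t.1 → s.2 = t.2) := by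
  rcases s with ⟨i, a⟩
  rcases t with ⟨j, b⟩
  cases a <;> cases b <;> simp [bar]

theorem mk_bar (s : α × Bool) : mk [bar s] = (mk [s])⁻¹ := mk_inv_letter s.1 s.2

theorem mk_append (u v : List (α × Bool)) : mk (u ++ v) = mk u * mk v := FreeGroup.mul_mk.symm

theorem mk_cons (s : α × Bool) (v : List (α × Bool)) : mk (s :: v) = mk [s] * mk v :=
  mk_append [s] v

theorem isReduced_cons {s : α × Bool} {v : List (α × Bool)} :
    IsReduced (s :: v) ↔ (∀ t ∈ v.head?, s ≠ bar t) ∧ IsReduced v := by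
  simp only [ne_bar_iff]
  exact List.isChain_cons

theorem isReduced_append {u v : List (α × Bool)} : IsReduced (u ++ v) ↔
    IsReduced u ∧ IsReduced v ∧ ∀ s ∈ u.getLast?, ∀ t ∈ v.head?, s ≠ bar t := by
  simp only [ne_bar_iff]
  exact List.isChain_append

theorem ne_bar_of_isReduced {u v : List (α × Bool)} {s t : α × Bool}
    (h : IsReduced (u ++ s :: t :: v)) : s ≠ bar t :=
  (isReduced_cons.1 (isReduced_append.1 h).2.1).1 t rfl

variable {Q : Type*} [MulAction (FreeGroup α) Q]

theorem bar_smul_smul (s : α × Bool) (x : Q) : mk [bar s] • mk [s] • x = x := by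
  rw [mk_bar, inv_smul_smul]

end Letters

/-! ### Finite sets of maximal excess. -/

section MaxExcess

variable {α Q : Type*} [Fintype α] [DecidableEq Q] [MulAction (FreeGroup α) Q]

variable (α) in
/-- `D` maximizes the excess `#darts - 2 * #vertices` among the finite non-empty sets of vertices
of the Schreier graph. -/
def IsMaxExcess (D : Finset Q) : Prop :=
  D.Nonempty ∧ ∀ D' : Finset Q, D'.Nonempty →
    #(darts (α := α) D') + 2 * #D ≤ #(darts (α := α) D) + 2 * #D'

theorem exists_isMaxExcess [Nonempty Q] {N : ℕ}
    (hN : ∀ D : Finset Q, D.Nonempty → #(darts (α := α) D) ≤ N + 2 * #D) :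
    ∃ D : Finset Q, IsMaxExcess α D := by
  let P : ℕ → Prop := fun m => ∃ D : Finset Q, D.Nonempty ∧ N + 2 * #D = #(darts (α := α) D) + m
  have hP : ∃ m, P m := by
    obtain ⟨x⟩ := ‹Nonempty Q›
    have := hN {x} (singleton_nonempty x)
    exact ⟨N + 2 * #{x} - #(darts (α := α) {x}), {x}, singleton_nonempty x, by omega⟩
  classical
  obtain ⟨D, hD, hDm⟩ := Nat.find_spec hP
  refine ⟨D, hD, fun D' hD' => ?_⟩
  have h1 := hN D' hD'
  have h2 := Nat.find_min' hP (m := N + 2 * #D' - #(darts (α := α) D')) ⟨D', hD', by omega⟩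
  omega

/-- The new vertex costs 2 and brings at least two darts, the joining edge in both directions.
Maximality leaves no room for a further dart. -/
theorem IsMaxExcess.insert_smul {D : Finset Q} (hD : IsMaxExcess α D) {x : Q} {s : α × Bool}
    (hx : x ∈ D) (hs : mk [s] • x ∉ D) : IsMaxExcess α (insert (mk [s] • x) D) ∧
      ∀ b, b ≠ bar s → mk [b] • mk [s] • x ∉ insert (mk [s] • x) D := by
  classical
  set y := mk [s] • x with hy
  have hyx : mk [bar s] • y = x := bar_smul_smul s x
  have hsub : darts (α := α) D ∪ {(x, s), (y, bar s)} ⊆ darts (insert y D) := by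
    intro e he
    simp only [mem_union, mem_insert, mem_singleton, mem_darts] at he ⊢
    rcases he with he | rfl | rfl
    · exact ⟨Or.inr he.1, Or.inr he.2⟩
    · exact ⟨Or.inr hx, Or.inl rfl⟩
    · exact ⟨Or.inl rfl, Or.inr (hyx ▸ hx)⟩
  have hne : (x, s) ≠ (y, bar s) := fun h => bar_ne_self s (congrArg Prod.snd h).symm
  have hcard : #(darts (α := α) D ∪ {(x, s), (y, bar s)}) = #(darts (α := α) D) + 2 := by
    rw [card_union_of_disjoint, card_pair hne]
    rw [disjoint_right]
    intro e he
    simp only [mem_insert, mem_singleton, mem_darts] at he ⊢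
    rcases he with rfl | rfl
    · exact fun h => hs h.2
    · exact fun h => hs h.1
  have hle := card_le_card hsub
  have hins := card_insert_of_notMem hs
  refine ⟨⟨insert_nonempty _ _, fun D' hD' => ?_⟩, fun b hb hbD => ?_⟩
  · have := hD.2 D' hD'
    omega
  · have hlt : darts (α := α) D ∪ {(x, s), (y, bar s)} ⊂ darts (insert y D) := by
      refine (ssubset_iff_of_subset hsub).2 ⟨(y, b), mem_darts.2 ⟨mem_insert_self _ _, hbD⟩, ?_⟩
      simp only [mem_union, mem_insert, mem_singleton, mem_darts, Prod.mk.injEq]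
      rintro (h | h | h)
      · exact hs h.1
      · exact hs (h.1 ▸ hx)
      · exact hb h.2
    have h1 := card_lt_card hlt
    have h2 := hD.2 _ (insert_nonempty y D)
    omega

/-- A reduced path that leaves a set of maximal excess does not come back. -/
theorem IsMaxExcess.notMem_of_isReduced (u : List (α × Bool)) :
    ∀ {D : Finset Q}, IsMaxExcess α D → ∀ {x : Q} {s : α × Bool}, x ∈ D → mk [s] • x ∉ D →
      IsReduced (u ++ [s]) → mk u • mk [s] • x ∉ D := by
  -- Words act from the left, so the last letter of `u` is travelled first. Absorb the vertex just
  -- reached into `D`; the rest of the path leaves the larger set.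
  induction u using List.reverseRecOn with
  | nil =>
    intro D _ x s _ hs _
    rwa [← FreeGroup.one_eq_mk, one_smul]
  | append_singleton u b ih =>
    intro D hD x s hx hs hu
    obtain ⟨hD', hb⟩ := hD.insert_smul hx hs
    rw [mk_append, mul_smul]
    have hu' : IsReduced (u ++ b :: s :: []) := by simpa using hu
    exact fun h => ih hD' (mem_insert_self _ _) (hb b (ne_bar_of_isReduced hu'))
      (hu.infix ⟨[], [s], by simp⟩) (mem_insert_of_mem h)

theorem IsMaxExcess.exists_superset_smul_mem {D : Finset Q} (hD : IsMaxExcess α D) {x : Q}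
    (hx : x ∈ D) (u : List (α × Bool)) : ∃ D', IsMaxExcess α D' ∧ D ⊆ D' ∧ mk u • x ∈ D' := by
  induction u with
  | nil => exact ⟨D, hD, Subset.rfl, by rwa [← FreeGroup.one_eq_mk, one_smul]⟩
  | cons a u ih =>
    obtain ⟨D', hD', hDD', hu⟩ := ih
    rw [mk_cons, mul_smul]
    by_cases h : mk [a] • mk u • x ∈ D'
    · exact ⟨D', hD', hDD', h⟩
    · exact ⟨_, (hD'.insert_smul hu h).1, hDD'.trans (subset_insert _ _), mem_insert_self _ _⟩

theorem IsMaxExcess.exists_superset [MulAction.IsPretransitive (FreeGroup α) Q] {D : Finset Q}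
    (hD : IsMaxExcess α D) (X : Finset Q) : ∃ D', IsMaxExcess α D' ∧ X ⊆ D' := by
  classical
  suffices ∃ D', IsMaxExcess α D' ∧ D ⊆ D' ∧ X ⊆ D' from
    let ⟨D', h, _, h'⟩ := this; ⟨D', h, h'⟩
  induction X using Finset.induction_on with
  | empty => exact ⟨D, hD, Subset.rfl, empty_subset _⟩
  | insert z X _ ih =>
    obtain ⟨D', hD', hDD', hX⟩ := ih
    obtain ⟨x, hx⟩ := hD'.1
    obtain ⟨g, rfl⟩ := MulAction.exists_smul_eq (FreeGroup α) x z
    obtain ⟨D'', hD'', hDD'', hz⟩ := hD'.exists_superset_smul_mem hx g.toWord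
    rw [FreeGroup.mk_toWord] at hz
    exact ⟨D'', hD'', hDD'.trans hDD'', insert_subset hz (hX.trans hDD'')⟩

variable (α) in
/-- The number of oriented edges of the Schreier graph from `x` to a vertex in `D`. -/
def degreeIn (D : Finset Q) (x : Q) : ℕ := #{s : α × Bool | mk [s] • x ∈ D}

theorem card_darts_eq_sum (D : Finset Q) : #(darts (α := α) D) = ∑ x ∈ D, degreeIn α D x := by
  classical
  rw [card_eq_sum_card_fiberwise (f := Prod.fst) (t := D) fun e he => (mem_darts.1 he).1]
  refine sum_congr rfl fun x hx => ?_
  refine card_nbij' Prod.snd (fun s => (x, s)) ?_ ?_ ?_ ?_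
  · rintro ⟨z, s⟩ h
    simp only [coe_filter, mem_darts, Set.mem_ofPred_eq] at h
    obtain ⟨⟨_, h⟩, rfl⟩ := h
    simpa using h
  · intro s h
    simpa [mem_darts, hx] using h
  · rintro ⟨z, s⟩ h
    simp only [coe_filter, mem_darts, Set.mem_ofPred_eq] at h
    simp [h.2]
  · intro s _
    rfl

theorem card_darts_le_erase (D : Finset Q) (y : Q) :
    #(darts (α := α) D) ≤ #(darts (α := α) (D.erase y)) + 2 * degreeIn α D y := by
  classical
  let S : Finset (α × Bool) := {s | mk [s] • y ∈ D}
  have hsub : darts (α := α) D ⊆ darts (D.erase y) ∪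
      (S.image (fun s => (y, s)) ∪ S.image fun s => (mk [s] • y, bar s)) := by
    rintro ⟨x, s⟩ he
    obtain ⟨h1, h2⟩ := mem_darts.1 he
    simp only at h1 h2
    simp only [mem_union, mem_darts, mem_image, mem_erase, S, mem_filter, mem_univ, true_and]
    by_cases hx : x = y
    · subst hx
      exact Or.inr (Or.inl ⟨s, h2, rfl⟩)
    by_cases hsx : mk [s] • x = y
    · subst hsx
      exact Or.inr (Or.inr ⟨bar s, by rwa [bar_smul_smul], by rw [bar_smul_smul, bar_bar]⟩)
    · exact Or.inl ⟨⟨hx, h1⟩, hsx, h2⟩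
  have hS : degreeIn α D y = #S := rfl
  have h1 := card_le_card hsub
  have h2 := card_union_le (darts (α := α) (D.erase y))
    (S.image (fun s => (y, s)) ∪ S.image fun s => (mk [s] • y, bar s))
  have h3 := card_union_le (S.image (fun s => (y, s))) (S.image fun s => (mk [s] • y, bar s))
  have h4 : #(S.image (fun s => (y, s))) ≤ #S := card_image_le
  have h5 : #(S.image (fun s => (mk [s] • y, bar s))) ≤ #S := card_image_le
  omega

theorem IsMaxExcess.erase_of_degreeIn_le_one {D : Finset Q} (hD : IsMaxExcess α D) {y : Q} (hy : y ∈ D)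
    (hdeg : degreeIn α D y ≤ 1) (hne : (D.erase y).Nonempty) : IsMaxExcess α (D.erase y) := by
  refine ⟨hne, fun D' hD' => ?_⟩
  have h1 := card_darts_le_erase (α := α) D y
  have h2 := hD.2 D' hD'
  have h3 := card_erase_add_one hy
  omega

/-- Erasing an isolated vertex would raise the excess by 2, and a loop would already give degree 2.
-/
theorem IsMaxExcess.exists_adj_erase {D : Finset Q} (hD : IsMaxExcess α D) {y : Q} (hy : y ∈ D)
    (hdeg : degreeIn α D y ≤ 1) (hne : (D.erase y).Nonempty) :
    ∃ x ∈ D.erase y, ∃ s : α × Bool, mk [s] • x = y := by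
  by_contra! hcon
  have hdeg0 : degreeIn α D y = 0 := by
    rw [degreeIn, card_eq_zero, filter_eq_empty_iff]
    intro s _ hs
    have hloop : mk [s] • y = y := by
      by_contra h
      exact hcon _ (mem_erase.2 ⟨h, hs⟩) (bar s) (bar_smul_smul s y)
    have hloop' : mk [bar s] • y = y := by
      conv_lhs => rw [← hloop]
      exact bar_smul_smul s y
    exact bar_ne_self s (card_le_one.1 hdeg (bar s) (by simp [hloop', hy]) s (by simp [hs]))
  have h1 := card_darts_le_erase (α := α) D y
  have h2 := hD.2 _ hne
  have h3 := card_erase_add_one hy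
  omega

end MaxExcess

/-! ### Colors of oriented edges. -/

section Colors

variable {α Q : Type*} [DecidableEq α] [MulAction (FreeGroup α) Q]

/-- Reading the word `h` or `h⁻¹` in the Schreier graph from the vertex `y`, one runs through the
oriented edge `s` from `x`. -/
def Crosses (h : FreeGroup α) (y x : Q) (s : α × Bool) : Prop :=
  ∃ u v, (u ++ s :: v = h.toWord ∨ u ++ s :: v = h⁻¹.toWord) ∧ mk v • y = x

/-- All translates of the axis of `h` through the oriented edge `s` from `x` have their base points
in `A` if `c` holds, and outside `A` otherwise. -/
def HasColor (h : FreeGroup α) (A : Set Q) (x : Q) (s : α × Bool) (c : Prop) : Prop :=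
  ∀ y, Crosses h y x s → (y ∈ A ↔ c)

/-- Every reduced word of length `L` is a subword of `h`. -/
def IsUniversal (h : FreeGroup α) (L : ℕ) : Prop :=
  ∀ u : List (α × Bool), IsReduced u → u.length = L → u <:+: h.toWord

/-- Repeating the first letter on the left pads the word to length `L` without cancellation. -/
theorem IsUniversal.infix_of_length_le {h : FreeGroup α} {L : ℕ} (hh : IsUniversal h L)
    {s : α × Bool} {t : List (α × Bool)} (ht : IsReduced (s :: t)) (hL : (s :: t).length ≤ L) :
    s :: t <:+: h.toWord := by
  have hred : IsReduced (List.replicate (L - (s :: t).length) s ++ s :: t) := by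
    refine isReduced_append.2 ⟨?_, ht, fun a ha b hb => ?_⟩
    · exact List.isChain_replicate_of_rel _ fun _ => rfl
    · have ha' := List.eq_of_mem_replicate (List.mem_of_mem_getLast? ha)
      have hb' : s = b := by simpa using hb
      rw [ha', ← hb']
      exact (bar_ne_self s).symm
  refine List.IsInfix.trans ⟨_, [], by rw [List.append_nil]⟩ (hh _ hred ?_)
  rw [List.length_append, List.length_replicate]
  omega

/-- Without a crossing, both colors would hold vacuously. -/
theorem IsUniversal.exists_crosses {h : FreeGroup α} {L : ℕ} (hh : IsUniversal h L) (hL : 1 ≤ L)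
    (x : Q) (s : α × Bool) : ∃ y, Crosses h y x s := by
  obtain ⟨u, v, huv⟩ := hh.infix_of_length_le (s := s) (t := []) FreeGroup.IsReduced.singleton hL
  exact ⟨(mk v)⁻¹ • x, u, v, Or.inl (by simpa using huv), smul_inv_smul _ _⟩

/-- A reading of `h` from some `y` enters along `a` reversed, follows `w` and exits along `b`. The
inverse reading from `h • y` exits along `a`, and `A` does not separate `y` from `h • y`. -/
theorem HasColor.iff_of_word {h : FreeGroup α} {L : ℕ} (hh : IsUniversal h L) {A : Set Q}
    (hA : ∀ y, h • y ∈ A ↔ y ∈ A) {x : Q} {a b : α × Bool} {w : List (α × Bool)} {c c' : Prop}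
    (hw : IsReduced (b :: (w ++ [bar a]))) (hwL : w.length + 2 ≤ L)
    (hc : HasColor h A x a c) (hc' : HasColor h A (mk w • x) b c') : c ↔ c' := by
  obtain ⟨u, v, huv⟩ := hh.infix_of_length_le hw (by simp; omega)
  let y := (mk (bar a :: v))⁻¹ • x
  have h1 : Crosses h y (mk w • x) b := by
    refine ⟨u, w ++ bar a :: v, Or.inl (by simpa using huv), ?_⟩
    rw [mk_append, mul_smul, smul_inv_smul]
  have h2 : Crosses h (h • y) x a := by
    refine ⟨invRev v, invRev (u ++ b :: w), Or.inr ?_, ?_⟩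
    · rw [FreeGroup.toWord_inv, ← huv]
      simp [invRev, bar]
    · have hword : h = mk (u ++ b :: w) * mk (bar a :: v) := by
        rw [← mk_append, ← FreeGroup.mk_toWord (x := h), ← huv]
        simp
      rw [← inv_mk, hword, mul_smul, inv_smul_smul, smul_inv_smul]
  rw [← hc _ h2, ← hc' _ h1, hA]

theorem HasColor.iff_of_same_vertex {h : FreeGroup α} {L : ℕ} (hh : IsUniversal h L) (hL : 2 ≤ L)
    {A : Set Q} (hA : ∀ y, h • y ∈ A ↔ y ∈ A) {x : Q} {a b : α × Bool} {c c' : Prop}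
    (hc : HasColor h A x a c) (hc' : HasColor h A x b c') : c ↔ c' := by
  by_cases hab : b = a
  · subst hab
    obtain ⟨y, hy⟩ := hh.exists_crosses (by omega) x b
    rw [← hc y hy, hc' y hy]
  · refine HasColor.iff_of_word (w := []) hh hA ?_ (by simpa using hL) hc
      (by rwa [← FreeGroup.one_eq_mk, one_smul])
    refine isReduced_cons.2 ⟨?_, FreeGroup.IsReduced.singleton⟩
    simpa [bar_bar] using hab

theorem smul_mem_iff_of_word {h : FreeGroup α} {A : Set Q} (hA : ∀ y, h • y ∈ A ↔ y ∈ A)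
    {l : List (α × Bool)} (hl : l = h.toWord ∨ l = h⁻¹.toWord) (y : Q) :
    mk l • y ∈ A ↔ y ∈ A := by
  rcases hl with rfl | rfl
  · rw [FreeGroup.mk_toWord, hA]
  · rw [FreeGroup.mk_toWord, ← hA, smul_inv_smul]

theorem ne_bar_of_isCyclicallyReduced {h : FreeGroup α}
    (hcyc : FreeGroup.IsCyclicallyReduced h.toWord) {l : List (α × Bool)}
    (hl : l = h.toWord ∨ l = h⁻¹.toWord) {a b : α × Bool} (ha : a ∈ l.getLast?)
    (hb : b ∈ l.head?) : a ≠ bar b := by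
  rcases hl with rfl | rfl
  · exact ne_bar_iff.2 (hcyc.2 a ha b hb)
  · rw [FreeGroup.toWord_inv] at ha hb
    have ha' : bar a ∈ h.toWord.head? := by
      simp only [invRev, List.getLast?_reverse, List.head?_map, Option.mem_def,
        Option.map_eq_some_iff] at ha
      obtain ⟨a', ha', rfl⟩ := ha
      simpa [bar] using ha'
    have hb' : bar b ∈ h.toWord.getLast? := by
      simp only [invRev, List.head?_reverse, List.getLast?_map, Option.mem_def,
        Option.map_eq_some_iff] at hb
      obtain ⟨b', hb', rfl⟩ := hb
      simpa [bar] using hb'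
    have := ne_bar_iff.2 (hcyc.2 _ hb' _ ha')
    rw [bar_bar] at this
    exact this.symm

/-- The color of an edge is determined by that of the edges following it. -/
theorem HasColor.of_next {h : FreeGroup α} (hcyc : FreeGroup.IsCyclicallyReduced h.toWord)
    {A : Set Q} (hA : ∀ y, h • y ∈ A ↔ y ∈ A) {x : Q} {s : α × Bool} {c : Prop}
    (hnext : ∀ b, b ≠ bar s → HasColor h A (mk [s] • x) b c) : HasColor h A x s c := by
  rintro y ⟨u, v, hl, rfl⟩
  rcases List.eq_nil_or_concat u with rfl | ⟨u', b, rfl⟩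
  -- Here `s` is the last letter read. The next edge belongs to the next period, based at `mk l •
  -- y`, and cyclic reducedness excludes backtracking.
  · rw [List.nil_append] at hl
    obtain ⟨u', b, hub⟩ : ∃ u' b, s :: v = u' ++ [b] :=
      ⟨_, _, (List.dropLast_append_getLast (List.cons_ne_nil s v)).symm⟩
    have hb : b ≠ bar s := ne_bar_of_isCyclicallyReduced hcyc hl (by simp [hub]) (by simp)
    rw [← smul_mem_iff_of_word hA hl y]
    refine hnext b hb _ ⟨u', [], by rwa [← hub], ?_⟩
    rw [← FreeGroup.one_eq_mk, one_smul, mk_cons, mul_smul]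
  · have hred : IsReduced (u' ++ b :: s :: v) := by
      rcases hl with hl | hl
      · have := FreeGroup.isReduced_toWord (x := h)
        rw [← hl] at this
        simpa using this
      · have := FreeGroup.isReduced_toWord (x := h⁻¹)
        rw [← hl] at this
        simpa using this
    refine hnext b (ne_bar_of_isReduced hred) _ ⟨u', s :: v, by simpa using hl, ?_⟩
    rw [mk_cons, mul_smul]

end Colors

/-! ### Pruning and the long path between the two colors. -/

section Good

variable {α Q : Type*} [Fintype α] [DecidableEq α] [DecidableEq Q] [MulAction (FreeGroup α) Q]

/-- `D` has maximal excess, every oriented edge leaving `D` has a color and both colors occur. -/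
structure IsGood (h : FreeGroup α) (A : Set Q) (D : Finset Q) : Prop where
  max : IsMaxExcess α D
  colored : ∀ x ∈ D, ∀ s, mk [s] • x ∉ D → ∃ c, HasColor h A x s c
  both : ∀ c : Prop, ∃ x ∈ D, ∃ s : α × Bool, mk [s] • x ∉ D ∧ HasColor h A x s c

/-- Once `D` contains the coboundary, membership in `A` is constant along a path outside `D`, so a
reading that leaves `D` ends on the side it first reached. For each color, a walk to `D` from an
outside vertex of that color enters along the reverse of an edge as required. -/
theorem exists_isGood [MulAction.IsPretransitive (FreeGroup α) Q] {h : FreeGroup α} {A : Set Q}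
    (hA : ∀ y, h • y ∈ A ↔ y ∈ A)
    (hfin : {x : Q | ∃ s : α × Bool, ¬(mk [s] • x ∈ A ↔ x ∈ A)}.Finite)
    (hinf : ∀ c : Prop, {x : Q | x ∈ A ↔ c}.Infinite)
    {D₀ : Finset Q} (hD₀ : IsMaxExcess α D₀) : ∃ D, IsGood h A D := by
  obtain ⟨D, hD, hX⟩ := hD₀.exists_superset hfin.toFinset
  have hout : ∀ x, x ∉ D → ∀ s : α × Bool, mk [s] • x ∈ A ↔ x ∈ A := by
    intro x hx s
    by_contra hs
    exact hx (hX (hfin.mem_toFinset.2 ⟨s, hs⟩))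
  have hcolor : ∀ x ∈ D, ∀ s, mk [s] • x ∉ D → HasColor h A x s (mk [s] • x ∈ A) := by
    rintro x hx s hs y ⟨u, v, hl, rfl⟩
    have hred : IsReduced (u ++ s :: v) := by
      rcases hl with hl | hl <;> rw [hl] <;> exact FreeGroup.isReduced_toWord
    have hpath : ∀ u' : List (α × Bool), IsReduced (u' ++ [s]) →
        (mk u' • mk [s] • mk v • y ∈ A ↔ mk [s] • mk v • y ∈ A) := by
      intro u' hu'
      induction u' with
      | nil => rw [← FreeGroup.one_eq_mk, one_smul]
      | cons a u' ih =>
        have hu'' := hu'.infix (L₁ := u' ++ [s]) ⟨[a], [], by simp⟩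
        rw [mk_cons, mul_smul, hout _ (hD.notMem_of_isReduced u' hx hs hu''), ih hu'']
    rw [← smul_mem_iff_of_word hA hl, mk_append, mul_smul, mk_cons, mul_smul]
    exact hpath u (hred.infix ⟨[], v, by simp⟩)
  refine ⟨D, hD, fun x hx s hs => ⟨_, hcolor x hx s hs⟩, fun c => ?_⟩
  obtain ⟨z, hzc, hzD⟩ := ((hinf c).sdiff D.finite_toSet).nonempty
  have hz : z ∉ D := fun h => hzD (mem_coe.2 h)
  have hwalk : ∀ u : List (α × Bool), (mk u • z ∉ D ∧ (mk u • z ∈ A ↔ z ∈ A)) ∨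
      ∃ x ∈ D, ∃ s : α × Bool, mk [s] • x ∉ D ∧ (mk [s] • x ∈ A ↔ z ∈ A) := by
    intro u
    induction u with
    | nil => rw [← FreeGroup.one_eq_mk, one_smul]; exact Or.inl ⟨hz, Iff.rfl⟩
    | cons a u ih =>
      rcases ih with ⟨h1, h2⟩ | ih
      · rw [mk_cons, mul_smul]
        by_cases ha : mk [a] • mk u • z ∈ D
        · exact Or.inr ⟨_, ha, bar a, by rwa [bar_smul_smul], by rwa [bar_smul_smul]⟩
        · exact Or.inl ⟨ha, (hout _ h1 a).trans h2⟩
      · exact Or.inr ih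
  obtain ⟨d, hd⟩ := hD.1
  obtain ⟨g, rfl⟩ := MulAction.exists_smul_eq (FreeGroup α) z d
  rcases hwalk g.toWord with ⟨h1, _⟩ | ⟨x, hx, s, hs, hsz⟩
  · rw [FreeGroup.mk_toWord] at h1
    exact absurd hd h1
  · have hsc : (mk [s] • x ∈ A) = c := propext (hsz.trans hzc)
    exact ⟨x, hx, s, hs, hsc ▸ hcolor x hx s hs⟩

/-- The edges leaving `D` at `y` share one color, because `h` contains all reduced words of length
2. The edge leading into `y` is followed only by such edges, so it inherits their color and replaces
them. -/
theorem isGood_erase {h : FreeGroup α}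
    (hcyc : FreeGroup.IsCyclicallyReduced h.toWord) {L : ℕ} (hh : IsUniversal h L) (hL : 2 ≤ L)
    {A : Set Q} (hA : ∀ y, h • y ∈ A ↔ y ∈ A) {D : Finset Q} (hD : IsGood h A D) {y : Q}
    (hy : y ∈ D) (hdeg : degreeIn α D y ≤ 1) (hne : (D.erase y).Nonempty) :
    IsGood h A (D.erase y) := by
  have hmax := hD.max.erase_of_degreeIn_le_one hy hdeg hne
  have hnew : ∀ x ∈ D.erase y, ∀ s : α × Bool, mk [s] • x = y → ∃ c, HasColor h A x s c ∧
      ∀ b : α × Bool, mk [b] • y ∉ D → HasColor h A y b c := by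
    rintro x hx s rfl
    have hout : ∀ b, b ≠ bar s → mk [b] • mk [s] • x ∉ D := by
      have := (hmax.insert_smul hx (notMem_erase _ _)).2
      rwa [insert_erase hy] at this
    obtain ⟨c, hc⟩ := hD.colored _ hy s (hout s (bar_ne_self s).symm)
    have hall : ∀ b, mk [b] • mk [s] • x ∉ D → HasColor h A (mk [s] • x) b c := by
      intro b hb
      obtain ⟨c', hc'⟩ := hD.colored _ hy b hb
      rwa [propext (hc.iff_of_same_vertex hh hL hA hc')]
    exact ⟨c, .of_next hcyc hA fun b hb => hall b (hout b hb), hall⟩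
  refine ⟨hmax, fun x hx s hs => ?_, fun c => ?_⟩
  · by_cases hxy : mk [s] • x = y
    · obtain ⟨c, hc, _⟩ := hnew x hx s hxy
      exact ⟨c, hc⟩
    · exact hD.colored x (mem_of_mem_erase hx) s fun h => hs (mem_erase.2 ⟨hxy, h⟩)
  · obtain ⟨x, hx, s, hs, hc⟩ := hD.both c
    by_cases hxy : x = y
    · subst hxy
      obtain ⟨z, hz, t, htz⟩ := hD.max.exists_adj_erase hy hdeg hne
      obtain ⟨c', hc', hall⟩ := hnew z hz t htz
      refine ⟨z, hz, t, htz ▸ notMem_erase _ _, ?_⟩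
      rwa [propext (hc.iff_of_same_vertex hh hL hA (hall s hs))]
    · exact ⟨x, mem_erase.2 ⟨hxy, hx⟩, s, fun h => hs (mem_of_mem_erase h), hc⟩

theorem exists_isGood_two_le_degreeIn {h : FreeGroup α}
    (hcyc : FreeGroup.IsCyclicallyReduced h.toWord) {L : ℕ} (hh : IsUniversal h L) (hL : 2 ≤ L)
    {A : Set Q} (hA : ∀ y, h • y ∈ A ↔ y ∈ A) (hex : ∃ D, IsGood h A D) :
    ∃ D, IsGood h A D ∧ ∀ y ∈ D, 2 ≤ degreeIn α D y := by
  -- A smallest good set cannot be pruned, nor be a single vertex of degree at most one, where both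
  -- colors would meet.
  obtain ⟨D, hD, hmin⟩ := WellFounded.has_min (measure (card : Finset Q → ℕ)).wf
    {D | IsGood h A D} hex
  refine ⟨D, hD, fun y hy => ?_⟩
  by_contra! hdeg
  rcases (D.erase y).eq_empty_or_nonempty with he | hne
  · have hsingle : ∀ x ∈ D, x = y := by
      intro x hx
      by_contra hxy
      simpa [he] using mem_erase.2 ⟨hxy, hx⟩
    obtain ⟨x, hx, s, -, hs⟩ := hD.both True
    obtain ⟨x', hx', s', -, hs'⟩ := hD.both False
    rw [hsingle x hx] at hs
    rw [hsingle x' hx'] at hs'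
    exact (hs.iff_of_same_vertex hh hL hA hs').1 trivial
  · exact hmin _ (isGood_erase hcyc hh hL hA hD hy (by omega) hne)
      (card_erase_lt_of_mem hy)

/-- There is a path of length at least `L - 1` in `D` whose interior vertices are distinct and have
all their neighbours in `D`. -/
theorem exists_interior_of_isGood [MulAction.IsPretransitive (FreeGroup α) Q] {h : FreeGroup α}
    {L : ℕ} (hh : IsUniversal h L) (hL : 2 ≤ L) {A : Set Q} (hA : ∀ y, h • y ∈ A ↔ y ∈ A)
    {D : Finset Q} (hD : IsGood h A D) : ∃ I ⊆ D, L ≤ #I + 2 ∧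
      ∀ x ∈ I, degreeIn α D x = 2 * Fintype.card α := by
  let B : Prop → Q → Prop := fun c x => x ∈ D ∧ ∃ s, mk [s] • x ∉ D ∧ HasColor h A x s c
  have hex : ∃ n, ∃ g : FreeGroup α, g.norm = n ∧ ∃ x, B True x ∧ B False (g • x) := by
    obtain ⟨x, hx⟩ := hD.both True
    obtain ⟨y, hy⟩ := hD.both False
    obtain ⟨g, rfl⟩ := MulAction.exists_smul_eq (FreeGroup α) x y
    exact ⟨_, g, rfl, x, hx, hy⟩
  classical
  obtain ⟨g, hg, x, hx, hgx⟩ := Nat.find_spec hex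
  have hmin : ∀ (w : List (α × Bool)) (y : Q), B True y → B False (mk w • y) →
      g.norm ≤ w.length := by
    intro w y hy hwy
    rw [hg]
    exact (Nat.find_min' hex ⟨mk w, rfl, y, hy, hwy⟩).trans FreeGroup.norm_mk_le
  have hwg : g = mk g.toWord := FreeGroup.mk_toWord.symm
  have hwred : IsReduced g.toWord := FreeGroup.isReduced_toWord
  have hlen : g.norm = g.toWord.length := rfl
  rw [hwg] at hgx
  rw [hlen] at hmin
  generalize g.toWord = w at *
  clear hwg hlen hg hex
  have hmem : ∀ v u, w = u ++ v → mk v • x ∈ D := by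
    intro v
    induction v with
    | nil => intro _ _; rw [← FreeGroup.one_eq_mk, one_smul]; exact hx.1
    | cons a v ih =>
      intro u huv
      by_contra hv
      rw [mk_cons, mul_smul] at hv
      refine hD.max.notMem_of_isReduced u (ih (u ++ [a]) (by simpa using huv)) hv
        (hwred.infix ⟨[], v, by simp [huv]⟩) ?_
      have := hgx.1
      rwa [huv, mk_append, mul_smul, mk_cons, mul_smul] at this
  -- A leaving edge at an interior vertex would have a color, hence give a shorter path between
  -- opposite colors.
  have hint : ∀ u v, w = u ++ v → u ≠ [] → v ≠ [] → ∀ s : α × Bool, mk [s] • mk v • x ∈ D := by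
    intro u v huv hu hv s
    by_contra hs
    have hvD := hmem v u huv
    have hul := List.length_pos_iff.2 hu
    have hvl := List.length_pos_iff.2 hv
    have hwl : w.length = u.length + v.length := by rw [huv, List.length_append]
    obtain ⟨c, hc⟩ := hD.colored _ hvD s hs
    by_cases hcp : c
    · have := hmin u (mk v • x) ⟨hvD, s, hs, by rwa [← eq_true hcp]⟩
        (by rwa [← mul_smul, ← mk_append, ← huv])
      omega
    · have := hmin v x hx ⟨hvD, s, hs, by rwa [← eq_false hcp]⟩
      omega
  have hinj : ∀ u₁ v₁ u₂ v₂, w = u₁ ++ v₁ → w = u₂ ++ v₂ → v₁.length < v₂.length →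
      mk v₁ • x ≠ mk v₂ • x := by
    intro u₁ v₁ u₂ v₂ h₁ h₂ hlt heq
    have := hmin (u₂ ++ v₁) x hx
      (by rwa [mk_append, mul_smul, heq, ← mul_smul, ← mk_append, ← h₂])
    have hwl : w.length = u₂.length + v₂.length := by rw [h₂, List.length_append]
    rw [List.length_append] at this
    omega
  -- Otherwise `b w a⁻¹` has length at most `L`. It is reduced because `w` stays in `D` while `a`
  -- and `b` leave it, so the colors would agree.
  have hlong : L ≤ w.length + 1 := by
    by_contra! hlt
    obtain ⟨-, a, ha, hca⟩ := hx
    obtain ⟨-, b, hb, hcb⟩ := hgx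
    refine (hca.iff_of_word hh hA (w := w) ?_ (by omega) hcb).1 trivial
    refine isReduced_cons.2 ⟨?_, isReduced_append.2 ⟨hwred, FreeGroup.IsReduced.singleton, ?_⟩⟩
    · intro t ht hbt
      rcases w with _ | ⟨c, w⟩
      · have hba : b = a := by
          have : bar a = t := by simpa using ht
          rw [hbt, ← this, bar_bar]
        subst hba
        rw [← FreeGroup.one_eq_mk, one_smul] at hcb
        exact (hca.iff_of_same_vertex hh hL hA hcb).1 trivial
      · have : c = t := by simpa using ht
        subst this
        rw [hbt, mk_cons c w, mul_smul, bar_smul_smul] at hb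
        exact hb (hmem w [c] rfl)
    · intro s hs t ht hst
      have hta : bar a = t := by simpa using ht
      rw [← hta, bar_bar] at hst
      subst hst
      obtain ⟨w', rfl⟩ : ∃ w', w = w' ++ [s] := by
        rcases List.eq_nil_or_concat w with rfl | ⟨w', b, rfl⟩
        · simp at hs
        · exact ⟨w', by simpa using hs⟩
      exact ha (hmem [s] w' rfl)
  have hsplit : ∀ i, w = w.take i ++ w.drop i := fun i => (List.take_append_drop i w).symm
  refine ⟨(Ioo 0 w.length).image fun i => mk (w.drop i) • x, ?_, ?_, ?_⟩
  · intro y hy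
    obtain ⟨i, -, rfl⟩ := mem_image.1 hy
    exact hmem _ _ (hsplit i)
  · rw [card_image_of_injOn, Nat.card_Ioo]
    · omega
    · intro i hi j hj hij
      have hi := mem_Ioo.1 (mem_coe.1 hi)
      have hj := mem_Ioo.1 (mem_coe.1 hj)
      rcases lt_trichotomy i j with hlt | heq | hlt
      · exact absurd hij.symm (hinj _ _ _ _ (hsplit j) (hsplit i) (by simp; omega))
      · exact heq
      · exact absurd hij (hinj _ _ _ _ (hsplit i) (hsplit j) (by simp; omega))
  · intro y hy
    obtain ⟨i, hi, rfl⟩ := mem_image.1 hy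
    have hi := mem_Ioo.1 hi
    have := hint _ _ (hsplit i)
      (by rw [← List.length_pos_iff, List.length_take]; omega)
      (by rw [← List.length_pos_iff, List.length_drop]; omega)
    rw [degreeIn, filter_true_of_mem fun s _ => this s, card_univ, Fintype.card_prod,
      Fintype.card_bool, mul_comm]

/-- Let a free group act transitively with point stabilizers generated by `r` elements, and let `A`
be an almost invariant set, infinite and with infinite complement. If `A` is invariant under a
cyclically reduced `h` containing all reduced words of length `L`, then `r` is large. -/
theorem lt_rank_stabilizer_of_almostInvariant [MulAction.IsPretransitive (FreeGroup α) Q]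
    [Nonempty α] {h : FreeGroup α} (hcyc : FreeGroup.IsCyclicallyReduced h.toWord) {L : ℕ}
    (hh : IsUniversal h L) (hL : 2 ≤ L) {A : Set Q} (hA : ∀ y, h • y ∈ A ↔ y ∈ A)
    (hfin : {x : Q | ∃ s : α × Bool, ¬(mk [s] • x ∈ A ↔ x ∈ A)}.Finite)
    (hinf : ∀ c : Prop, {x : Q | x ∈ A ↔ c}.Infinite) {r : ℕ} (t : Fin r → FreeGroup α) (q : Q)
    (ht : Subgroup.closure (Set.range t) = MulAction.stabilizer (FreeGroup α) q) :
    (Fintype.card α - 1) * (L - 2) < r := by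
  have hrank := card_darts_add_two_le t q ht
  have : Nonempty Q := ⟨q⟩
  obtain ⟨D₀, hD₀⟩ := exists_isMaxExcess (α := α) (Q := Q) (N := 2 * r)
    fun D hD => by have := hrank D hD; omega
  obtain ⟨D, hD, hdeg⟩ := exists_isGood_two_le_degreeIn hcyc hh hL hA
    (exists_isGood hA hfin hinf hD₀)
  obtain ⟨I, hID, hI, hIdeg⟩ := exists_interior_of_isGood hh hL hA hD
  have hα : 1 ≤ Fintype.card α := Fintype.card_pos
  have h1 := hrank D hD.max.1
  have h2 : ∑ x ∈ D, (2 + if x ∈ I then 2 * (Fintype.card α - 1) else 0) ≤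
      ∑ x ∈ D, degreeIn α D x := by
    refine sum_le_sum fun x hx => ?_
    split_ifs with hxI
    · rw [hIdeg x hxI]; omega
    · exact hdeg x hx
  rw [← card_darts_eq_sum, sum_add_distrib, sum_const, smul_eq_mul, sum_ite_mem,
    inter_eq_right.2 hID, sum_const, smul_eq_mul] at h2
  have h3 : (L - 2) * (2 * (Fintype.card α - 1)) ≤ #I * (2 * (Fintype.card α - 1)) :=
    Nat.mul_le_mul_right _ (by omega)
  have h4 : (L - 2) * (2 * (Fintype.card α - 1)) = 2 * ((Fintype.card α - 1) * (L - 2)) := by ring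
  omega

end Good

end FreeGroupAction

namespace BassSerre

/-! ### Half-trees and absence of leaves. -/

section Tree

variable {G V : Type*} [Group G] [MulAction G V] {T : SimpleGraph V}

/-- The half-tree at `v` of the edge with endpoints `v` and `w`. -/
def side (T : SimpleGraph V) (v w : V) : Set V := {z | (T.deleteEdges {s(v, w)}).Reachable z v}

theorem mem_side_self (v w : V) : v ∈ side T v w := SimpleGraph.Reachable.rfl

theorem notMem_side (hT : T.IsTree) {v w : V} (hvw : T.Adj v w) : w ∉ side T v w := fun h =>
  SimpleGraph.isBridge_iff.1 (SimpleGraph.isAcyclic_iff_forall_adj_isBridge.1 hT.isAcyclic hvw)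
    h.symm

theorem disjoint_side (hT : T.IsTree) {v w : V} (hvw : T.Adj v w) :
    Disjoint (side T v w) (side T w v) := by
  rw [Set.disjoint_left]
  intro z hz hz'
  refine notMem_side hT hvw (SimpleGraph.Reachable.trans ?_ hz)
  have h : (T.deleteEdges {s(w, v)}).Reachable z w := hz'
  rw [Sym2.eq_swap] at h
  exact h.symm

theorem mem_side_of_adj {v w a b : V} (hab : T.Adj a b) (hne : s(a, b) ≠ s(v, w))
    (hb : b ∈ side T v w) : a ∈ side T v w :=
  (SimpleGraph.Adj.reachable (SimpleGraph.deleteEdges_adj.2 ⟨hab, hne⟩)).trans hb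

theorem eq_of_adj_of_mem_side {v w a b : V} (hab : T.Adj a b)
    (ha : a ∈ side T v w) (hb : b ∉ side T v w) : a = v ∧ b = w := by
  by_cases h : s(b, a) = s(v, w)
  · rcases Sym2.eq_iff.1 h with ⟨rfl, rfl⟩ | ⟨rfl, rfl⟩
    · exact absurd (mem_side_self _ _) hb
    · exact ⟨rfl, rfl⟩
  · exact absurd (mem_side_of_adj hab.symm h ha) hb

/-- Paths from a half-tree to its complement pass through both ends of the edge. -/
theorem mem_support_of_mem_side {v w a b : V} (p : T.Walk a b) (ha : a ∈ side T v w) (hb : b ∉ side T v w) : w ∈ p.support := by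
  obtain ⟨d, hd, h1, h2⟩ := p.exists_boundary_dart _ ha hb
  rw [← (eq_of_adj_of_mem_side d.adj h1 h2).2]
  exact p.dart_snd_mem_support_of_mem_darts hd

theorem smul_mem_side (hadj : ∀ (g : G) (a b : V), T.Adj a b → T.Adj (g • a) (g • b)) {v w : V}
    {g : G} (hg : g ∈ edgeGroup G v w) {z : V} (hz : z ∈ side T v w) : g • z ∈ side T v w := by
  obtain ⟨hv, hw⟩ := Subgroup.mem_inf.1 hg
  rw [MulAction.mem_stabilizer_iff] at hv hw
  let f : T.deleteEdges {s(v, w)} →g T.deleteEdges {s(v, w)} :=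
    { toFun := fun z => g • z
      map_rel' := by
        intro a b hab
        obtain ⟨h1, h2⟩ := SimpleGraph.deleteEdges_adj.1 hab
        refine SimpleGraph.deleteEdges_adj.2 ⟨hadj g a b h1, fun h => h2 ?_⟩
        have h : s(g • a, g • b) = s(g • v, g • w) := by rw [hv, hw]; exact h
        simpa [Sym2.eq_iff] using h }
  have := SimpleGraph.Reachable.map f hz
  rwa [show f v = v from hv] at this

theorem smul_mem_side_iff (hadj : ∀ (g : G) (a b : V), T.Adj a b → T.Adj (g • a) (g • b))
    {v w : V} {g : G} (hg : g ∈ edgeGroup G v w) {z : V} :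
    g • z ∈ side T v w ↔ z ∈ side T v w :=
  ⟨fun h => by simpa using smul_mem_side hadj (inv_mem hg) h, smul_mem_side hadj hg⟩

theorem dist_smul_smul_le (hT : T.Connected)
    (hadj : ∀ (g : G) (a b : V), T.Adj a b → T.Adj (g • a) (g • b)) (g : G) (a b : V) :
    T.dist (g • a) (g • b) ≤ T.dist a b := by
  obtain ⟨p, hp⟩ := hT.exists_walk_length_eq_dist a b
  let f : T →g T := ⟨fun z => g • z, hadj g _ _⟩
  rw [← hp, ← SimpleGraph.Walk.length_map f p]
  exact SimpleGraph.dist_le _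

theorem dist_le_dist_of_mem_side (hT : T.Connected) {v w a b : V} (ha : a ∈ side T v w) (hb : b ∉ side T v w) : T.dist a w ≤ T.dist a b := by
  classical
  obtain ⟨p, hp⟩ := hT.exists_walk_length_eq_dist a b
  have hw := mem_support_of_mem_side p ha hb
  rw [← hp]
  exact (SimpleGraph.dist_le _).trans (p.length_takeUntil_le_length hw)

/-- A vertex with two neighbours. -/
def IsInner (T : SimpleGraph V) (z : V) : Prop := ∃ a b, a ≠ b ∧ T.Adj z a ∧ T.Adj z b

theorem isInner_of_mem_support {a b : V} (p : T.Walk a b) (hp : p.IsPath) (hb : IsInner T b)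
    (ha : ∃ c, T.Adj a c ∧ c ∉ p.support) : ∀ x ∈ p.support, IsInner T x := by
  induction p with
  | nil => simpa using hb
  | cons hadj p ih =>
    rw [SimpleGraph.Walk.cons_isPath_iff] at hp
    intro x hx
    rcases List.mem_cons.1 (by simpa using hx) with rfl | hx
    · obtain ⟨c, hc, hcp⟩ := ha
      refine ⟨c, _, ?_, hc, hadj⟩
      rintro rfl
      exact hcp (by simp)
    · exact ih hp.1 hb ⟨_, hadj.symm, hp.2⟩ x hx

theorem exists_adj_notMem_support (hT : T.IsTree) {a b : V} (p : T.Walk a b) (hp : p.IsPath)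
    (ha : IsInner T a) : ∃ c, T.Adj a c ∧ c ∉ p.support := by
  obtain ⟨c, d, hcd, hc, hd⟩ := ha
  by_contra! h
  exact hcd ((hT.isAcyclic.eq_snd_of_adj_start hp hc (h c hc)).trans
    (hT.isAcyclic.eq_snd_of_adj_start hp hd (h d hd)).symm)

/-- Otherwise `T` is a single edge, fixed by the whole group for lack of inversions. -/
theorem IsSplitting.exists_isInner (hT : IsSplitting G T) {v w : V} (hvw : T.Adj v w) :
    IsInner T v ∨ IsInner T w := by
  by_contra! hcon
  obtain ⟨hv, hw⟩ := hcon
  have hv' : ∀ z, T.Adj v z → z = w := fun z hz => by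
    by_contra h
    exact hv ⟨z, w, h, hz, hvw⟩
  have hw' : ∀ z, T.Adj w z → z = v := fun z hz => by
    by_contra h
    exact hw ⟨z, v, h, hz, hvw.symm⟩
  have hall : ∀ z, z = v ∨ z = w := by
    intro z
    by_contra hz
    obtain ⟨p⟩ := hT.isTree.connected.preconnected v z
    obtain ⟨d, -, h1, h2⟩ := p.exists_boundary_dart {z | z = v ∨ z = w} (Or.inl rfl) hz
    rcases h1 with h1 | h1
    · exact h2 (Or.inr (hv' _ (h1 ▸ d.adj)))
    · exact h2 (Or.inl (hw' _ (h1 ▸ d.adj)))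
  refine hT.nontrivial v ((Subgroup.eq_top_iff' _).2 fun g => ?_)
  rw [MulAction.mem_stabilizer_iff]
  refine (hall (g • v)).resolve_right fun hgv => hT.not_inversion g v w hvw ⟨hgv, ?_⟩
  refine (hall (g • w)).resolve_right fun hgw => hvw.ne ?_
  exact MulAction.injective g (hgv.trans hgw.symm)

/-- Paths between inner vertices stay inner, so these span an invariant subtree, which is everything
by minimality. -/
theorem IsSplitting.isInner (hT : IsSplitting G T) {v w : V} (hvw : T.Adj v w) (z : V) :
    IsInner T z := by
  suffices {z | IsInner T z} = Set.univ from Set.eq_univ_iff_forall.1 this z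
  refine hT.minimal _ ?_ ?_
  · rw [SimpleGraph.connected_iff]
    refine ⟨?_, ?_⟩
    · rintro ⟨a, ha⟩ ⟨b, hb⟩
      obtain ⟨p, hp, -⟩ := hT.isTree.existsUnique_path a b
      exact ⟨p.induce _ (isInner_of_mem_support p hp hb
        (exists_adj_notMem_support hT.isTree p hp ha))⟩
    · rcases hT.exists_isInner hvw with h | h
      exacts [⟨_, h⟩, ⟨_, h⟩]
  · rintro g z ⟨a, b, hab, ha, hb⟩
    exact ⟨g • a, g • b, fun h => hab (MulAction.injective g h), hT.adj_smul g _ _ ha,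
      hT.adj_smul g _ _ hb⟩

/-- Half-trees are unbounded. -/
theorem IsSplitting.exists_dist_ge (hT : IsSplitting G T) {v w : V} (hvw : T.Adj v w) (n : ℕ) :
    ∃ z ∈ side T v w, n ≤ T.dist z w := by
  classical
  -- Keeping `v` on the path ensures that prolonging it at `z` does not cross the edge `vw`.
  suffices ∃ z ∈ side T v w, ∃ p : T.Walk z w, p.IsPath ∧ v ∈ p.support ∧ n ≤ p.length by
    obtain ⟨z, hz, p, hp, -, hn⟩ := this
    obtain ⟨q, hq, hql⟩ := hT.isTree.connected.exists_path_of_dist z w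
    rw [(hT.isTree.existsUnique_path z w).unique hp hq, hql] at hn
    exact ⟨z, hz, hn⟩
  induction n with
  | zero =>
    exact ⟨v, mem_side_self v w, hvw.toWalk, by simpa using hvw.ne, by simp, Nat.zero_le _⟩
  | succ n ih =>
    obtain ⟨z, hz, p, hp, hv, hn⟩ := ih
    obtain ⟨c, hc, hcp⟩ := exists_adj_notMem_support hT.isTree p hp (hT.isInner hvw z)
    refine ⟨c, mem_side_of_adj hc.symm ?_ hz, p.cons hc.symm, hp.cons hcp, ?_, by simpa using hn⟩
    · intro h
      have : c ∈ s(v, w) := h ▸ Sym2.mem_mk_left c z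
      rcases Sym2.mem_iff.1 this with rfl | rfl
      · exact hcp hv
      · exact hcp p.end_mem_support
    · simp [hv]

end Tree

/-! ### The almost invariant set of a half-tree. -/

section FreeGroup

variable {α V : Type*} [Fintype α] [MulAction (FreeGroup α) V] {T : SimpleGraph V}

/-- Every orbit of a splitting of a finitely generated free group is cobounded. -/
theorem IsSplitting.exists_dist_orbit_le (hT : IsSplitting (FreeGroup α) T) (p : V) :
    ∃ K, ∀ z, ∃ g : FreeGroup α, T.dist z (g • p) ≤ K := by
  -- With this `K`, geodesics from `g • p` to `(g * of i) • p` stay in `S`, which makes `S`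
  -- connected.
  let K := Finset.univ.sup fun i : α => T.dist p (FreeGroup.of i • p)
  refine ⟨K, fun z => ?_⟩
  let S : Set V := {z | ∃ g : FreeGroup α, T.dist z (g • p) ≤ K}
  suffices S = Set.univ from Set.eq_univ_iff_forall.1 this z
  have hwalk : ∀ (g : FreeGroup α) (a : V), T.dist a (g • p) ≤ K →
      ∀ (ha : a ∈ S) (hg : g • p ∈ S), (T.induce S).Reachable ⟨a, ha⟩ ⟨g • p, hg⟩ := by
    classical
    intro g a hag ha hg
    obtain ⟨q, hq⟩ := hT.isTree.connected.exists_walk_length_eq_dist a (g • p)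
    refine ⟨q.induce S fun x hx => ⟨g, ?_⟩⟩
    exact (SimpleGraph.dist_le (q.dropUntil x hx)).trans
      ((q.length_dropUntil_le_length hx).trans (hq.trans_le hag))
  have horb : ∀ g : FreeGroup α, g • p ∈ S := fun g => ⟨g, by simp⟩
  have hof : ∀ (g : FreeGroup α) (i : α), (T.induce S).Reachable ⟨g • p, horb g⟩
      ⟨(g * FreeGroup.of i) • p, horb _⟩ := by
    refine fun g i => hwalk _ _ ?_ _ _
    rw [mul_smul]
    refine (dist_smul_smul_le hT.isTree.connected hT.adj_smul g _ _).trans ?_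
    exact Finset.le_sup (f := fun i : α => T.dist p (FreeGroup.of i • p)) (Finset.mem_univ i)
  have hreach : ∀ g g' : FreeGroup α, (T.induce S).Reachable ⟨g' • p, horb g'⟩
      ⟨(g' * g) • p, horb _⟩ := by
    intro g
    induction g using FreeGroup.induction_on with
    | C1 => intro g'; simp
    | of i => exact fun g' => hof g' i
    | inv_of i _ =>
      intro g'
      have := hof (g' * (FreeGroup.of i)⁻¹) i
      simp only [inv_mul_cancel_right] at this
      exact this.symm
    | mul g₁ g₂ h₁ h₂ =>
      intro g'
      have := (h₁ g').trans (h₂ (g' * g₁))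
      simpa only [mul_assoc] using this
  refine hT.minimal S ?_ ?_
  · rw [SimpleGraph.connected_iff_exists_forall_reachable]
    refine ⟨⟨(1 : FreeGroup α) • p, horb 1⟩, ?_⟩
    rintro ⟨a, g, hg⟩
    have h1 := hreach g 1
    simp only [one_mul] at h1
    exact h1.trans (hwalk g a hg ⟨g, hg⟩ (horb g)).symm
  · rintro g z ⟨g', hg'⟩
    refine ⟨g * g', ?_⟩
    rw [mul_smul]
    exact (dist_smul_smul_le hT.isTree.connected hT.adj_smul g _ _).trans hg'

/-- The cosets `g H` such that `g⁻¹ • p` is in the half-tree at `v` of the edge from `v` to `w`. -/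
def sideCosets (T : SimpleGraph V) (H : Subgroup (FreeGroup α)) (p v w : V) :
    Set (FreeGroup α ⧸ H) := {x | ∃ g : FreeGroup α, (g : FreeGroup α ⧸ H) = x ∧
      g⁻¹ • p ∈ side T v w}

omit [Fintype α] in
theorem mk_mem_sideCosets (hT : IsSplitting (FreeGroup α) T) {H : Subgroup (FreeGroup α)} {v w : V}
    (hH : H ≤ edgeGroup (FreeGroup α) v w) {p : V} (g : FreeGroup α) :
    (g : FreeGroup α ⧸ H) ∈ sideCosets T H p v w ↔ g⁻¹ • p ∈ side T v w := by
  refine ⟨?_, fun h => ⟨g, rfl, h⟩⟩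
  rintro ⟨g', hg', h⟩
  have := hH (QuotientGroup.eq.1 hg'.symm)
  rw [← smul_mem_side_iff hT.adj_smul this, mul_smul, smul_inv_smul] at h
  exact h

/-- As `H` fixes `w`, the distance from `g⁻¹ • p` to `w` depends only on `gH`. Finitely many cosets
would bound the orbit within the half-tree, which is unbounded while the orbit is cobounded. -/
theorem infinite_sideCosets (hT : IsSplitting (FreeGroup α) T) {H : Subgroup (FreeGroup α)}
    {v w : V} (hvw : T.Adj v w) (hH : H ≤ edgeGroup (FreeGroup α) v w) (p : V) :
    (sideCosets T H p v w).Infinite := by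
  intro hfin
  obtain ⟨K, hK⟩ := hT.exists_dist_orbit_le p
  obtain ⟨N, hN⟩ := (hfin.image fun x => T.dist (x.out⁻¹ • p) w).bddAbove
  have hbound : ∀ g : FreeGroup α, g • p ∈ side T v w → T.dist (g • p) w ≤ N := by
    intro g hg
    let x : FreeGroup α ⧸ H := ((g⁻¹ : FreeGroup α) : FreeGroup α ⧸ H)
    have hx : x ∈ sideCosets T H p v w := ⟨g⁻¹, rfl, by rwa [inv_inv]⟩
    have hmem : g * x.out ∈ H := by
      have := QuotientGroup.eq.1 (show ((g⁻¹ : FreeGroup α) : FreeGroup α ⧸ H) = x.out from x.out_eq'.symm)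
      rwa [inv_inv] at this
    have hw : (g * x.out) • w = w := MulAction.mem_stabilizer_iff.1 (hH hmem).2
    have h1 := dist_smul_smul_le hT.isTree.connected hT.adj_smul (g * x.out) (x.out⁻¹ • p) w
    rw [hw, mul_smul, smul_inv_smul] at h1
    exact h1.trans (hN ⟨x, hx, rfl⟩)
  obtain ⟨z, hz, hzw⟩ := hT.exists_dist_ge hvw (K + N + 1)
  obtain ⟨g, hg⟩ := hK z
  by_cases hgs : g • p ∈ side T v w
  · have h1 := hbound g hgs
    have h2 := hT.isTree.connected.dist_triangle (u := z) (v := g • p) (w := w)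
    omega
  · have := dist_le_dist_of_mem_side hT.isTree.connected hz hgs
    omega

/-- If the edge `s` at `gH` is in the coboundary, `g⁻¹` carries a fixed path from `p` to `s⁻¹ • p`
across `vw`. So `g • v` and `g • w` lie on one of finitely many paths, and they determine the coset.
-/
theorem finite_coboundary_sideCosets (hT : IsSplitting (FreeGroup α) T) (v w p : V) : {x | ∃ s : α × Bool, ¬(FreeGroup.mk [s] • x ∈
      sideCosets T (edgeGroup (FreeGroup α) v w) p v w ↔
        x ∈ sideCosets T (edgeGroup (FreeGroup α) v w) p v w)}.Finite := by
  let q := fun s : α × Bool =>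
    (hT.isTree.connected.preconnected p ((FreeGroup.mk [s])⁻¹ • p)).some
  let E : V → V → Set (FreeGroup α ⧸ edgeGroup (FreeGroup α) v w) := fun a b =>
    {x | ∃ g : FreeGroup α, (g : FreeGroup α ⧸ edgeGroup (FreeGroup α) v w) = x ∧
      g • v = a ∧ g • w = b}
  have hE : ∀ a b, (E a b).Finite := by
    intro a b
    refine Set.Subsingleton.finite ?_
    rintro _ ⟨g, rfl, h1, h2⟩ _ ⟨g', rfl, h1', h2'⟩
    refine QuotientGroup.eq.2 (Subgroup.mem_inf.2 ⟨?_, ?_⟩) <;>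
      rw [MulAction.mem_stabilizer_iff, mul_smul, inv_smul_eq_iff]
    · rw [h1, h1']
    · rw [h2, h2']
  refine Set.Finite.subset (Set.finite_iUnion fun s : α × Bool =>
    (q s).support.finite_toSet.biUnion fun a _ =>
      (q s).support.finite_toSet.biUnion fun b _ => hE a b) ?_
  rintro x ⟨s, hs⟩
  induction x using QuotientGroup.induction_on with | H g => ?_
  rw [MulAction.Quotient.smul_coe, mk_mem_sideCosets hT le_rfl, mk_mem_sideCosets hT le_rfl,
    smul_eq_mul, mul_inv_rev, mul_smul] at hs
  let S : Set V := {a | g⁻¹ • a ∈ side T v w}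
  have key : ∃ a ∈ (q s).support, ∃ b ∈ (q s).support, g⁻¹ • a = v ∧ g⁻¹ • b = w := by
    by_cases hp : p ∈ S
    · obtain ⟨d, hd, h1, h2⟩ := (q s).exists_boundary_dart S hp
        fun h => hs (iff_of_true h hp)
      exact ⟨_, (q s).dart_fst_mem_support_of_mem_darts hd, _,
        (q s).dart_snd_mem_support_of_mem_darts hd,
        eq_of_adj_of_mem_side (hT.adj_smul g⁻¹ _ _ d.adj) h1 h2⟩
    · obtain ⟨d, hd, h1, h2⟩ := (q s).exists_boundary_dart Sᶜ hp
        fun h => hs (iff_of_false h hp)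
      exact ⟨_, (q s).dart_snd_mem_support_of_mem_darts hd, _,
        (q s).dart_fst_mem_support_of_mem_darts hd,
        eq_of_adj_of_mem_side (hT.adj_smul g⁻¹ _ _ d.adj.symm) (not_not.1 h2) h1⟩
  obtain ⟨a, ha, b, hb, hav, hbw⟩ := key
  exact Set.mem_iUnion.2 ⟨s, Set.mem_biUnion ha (Set.mem_biUnion hb
    ⟨g, rfl, (inv_smul_eq_iff.1 hav).symm, (inv_smul_eq_iff.1 hbw).symm⟩)⟩

end FreeGroup

end BassSerre

/-! ### Generators of the edge group and conclusion. -/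

theorem Subgroup.exists_closure_range_eq_of_mulEquiv {G : Type*} [Group G] {H : Subgroup G} {r : ℕ}
    (e : H ≃* FreeGroup (Fin r)) : ∃ t : Fin r → G, Subgroup.closure (Set.range t) = H := by
  refine ⟨fun j => e.symm (FreeGroup.of j), ?_⟩
  have h := congrArg (Subgroup.map (H.subtype.comp e.symm.toMonoidHom))
    (FreeGroup.closure_range_of (Fin r))
  rw [MonoidHom.map_closure, ← Set.range_comp] at h
  refine h.trans ?_
  rw [← MonoidHom.range_eq_map, MonoidHom.range_comp, MonoidHom.range_eq_top.2 e.symm.surjective,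
    ← MonoidHom.range_eq_map, Subgroup.range_subtype]

theorem theorem1p5 (k L r : ℕ) (hk : 2 ≤ k) (hL : 2 ≤ L)
    (h : FreeGroup (Fin k))
    (hcyc : FreeGroup.IsCyclicallyReduced h.toWord)
    (hsub : ∀ u : List (Fin k × Bool), FreeGroup.IsReduced u → u.length = L → u <:+: h.toWord)
    {V : Type*} [MulAction (FreeGroup (Fin k)) V] (T : SimpleGraph V)
    (H : Subgroup (FreeGroup (Fin k)))
    (hT : BassSerre.IsSplittingOver T H)
    (hr : Nonempty (H ≃* FreeGroup (Fin r)))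
    (hell : BassSerre.IsElliptic V h) :
    ((k : ℤ) - 1) * ((L : ℤ) - 2) < (r : ℤ) := by
  classical
  obtain ⟨hT, v, w, hvw, rfl⟩ := hT
  obtain ⟨p, hp⟩ := hell
  obtain ⟨t, ht⟩ := Subgroup.exists_closure_range_eq_of_mulEquiv hr.some
  set H := BassSerre.edgeGroup (FreeGroup (Fin k)) v w with hH
  let A := BassSerre.sideCosets T H p v w
  have : Nonempty (Fin k) := ⟨⟨0, by omega⟩⟩
  have hA : ∀ y, h • y ∈ A ↔ y ∈ A := by
    intro y
    induction y using QuotientGroup.induction_on with | H g => ?_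
    rw [MulAction.Quotient.smul_coe, BassSerre.mk_mem_sideCosets hT le_rfl,
      BassSerre.mk_mem_sideCosets hT le_rfl, smul_eq_mul, mul_inv_rev, mul_smul,
      inv_smul_eq_iff.2 hp.symm]
  have hinf : ∀ c : Prop, {x | x ∈ A ↔ c}.Infinite := by
    intro c
    by_cases hc : c
    · refine (BassSerre.infinite_sideCosets hT hvw hH.le p).mono fun x hx => ?_
      exact iff_of_true hx hc
    -- The complement of `A` contains the cosets of the opposite half-tree.
    · have hle : H ≤ BassSerre.edgeGroup (FreeGroup (Fin k)) w v := inf_comm _ _ |>.le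
      refine (BassSerre.infinite_sideCosets hT hvw.symm hle p).mono ?_
      rintro _ ⟨g, rfl, hg⟩
      refine iff_of_false (fun hgA => ?_) hc
      exact Set.disjoint_left.1 (BassSerre.disjoint_side hT.isTree hvw)
        ((BassSerre.mk_mem_sideCosets hT le_rfl g).1 hgA) hg
  have hlt := FreeGroupAction.lt_rank_stabilizer_of_almostInvariant hcyc hsub hL hA
    (BassSerre.finite_coboundary_sideCosets hT v w p) hinf t
    ((1 : FreeGroup (Fin k)) : FreeGroup (Fin k) ⧸ H) (by rw [ht, MulAction.stabilizer_quotient])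
  rw [Fintype.card_fin] at hlt
  zify [show 1 ≤ k by omega, hL] at hlt
  exact hlt
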